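/- Let $p$ be a prime and let $G = H_1 \times \cdots \times H_r$, $r \ge 1$, be a direct product of (topologically) finitely generated pro-$p$ groups $H_j$, each of positive rank gradient, that is $$\inf_{U} \frac{d(U)-1}{|H_j : U|} > 0,$$ where $U$ runs over the open subgroups of $H_j$ and $d(U)$ is the minimal number of topological generators of $U$. Let $\mathcal F$ be the Frattini series of $G$: $\Phi_0(G) = G$, and for $i \ge 1$, $\Phi_i(G) = [\Phi_{i-1}(G),\Phi_{i-1}(G)]\,\Phi_{i-1}(G)^p$, the closed subgroup generated by all commutators and all $p$-th powers of elements of $\Phi_{i-1}(G)$. Then $$d_{\mathcal F}(x,y) = \inf\{\, |G:\Phi_i(G)|^{-1} \mid i \ge 0,\ x^{-1}y \in \Phi_i(G) \,\}$$ is a metric on $G$, and the Hausdorff dimension of every closed subgroup $K \le G$ with respect to $d_{\mathcal F}$ equals $$\operatorname{hdim}_G^{\mathcal F}(K) = \liminf_{i\to\infty} \frac{\log_p |K : K\cap \Phi_i(G)|}{\log_p |G:\Phi_i(G)|}.$$ Moreover $G$ has full Hausdorff spectrum with respect to $\mathcal F$: $$\operatorname{hspec}^{\mathcal F}(G) = \{\operatorname{hdim}_G^{\mathcal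 F}(K) \mid K \le G \text{ a closed subgroup}\} = [0,1].$$ -/

import Mathlib

/-- `G` is a pro-`p` group: a compact, Hausdorff, totally disconnected topological group in
which every open normal subgroup has index a power of `p`. -/
structure IsProP (p : ℕ) (G : Type*) [Group G] [TopologicalSpace G] : Prop where
  topGroup : IsTopologicalGroup G
  compact : CompactSpace G
  t2 : T2Space G
  totallyDisconnected : TotallyDisconnectedSpace G
  index_eq : ∀ N : Subgroup G, N.Normal → IsOpen (N : Set G) → ∃ k : ℕ, N.index = p ^ k

/-- The finite set `s` generates `G` topologically: the abstract subgroup generated by `s` is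
dense in `G`. -/
def TopGenerates {G : Type*} [Group G] [TopologicalSpace G] (s : Finset G) : Prop :=
  Dense (Subgroup.closure (s : Set G) : Set G)

/-- `G` is topologically finitely generated. -/
def IsTopFG (G : Type*) [Group G] [TopologicalSpace G] : Prop :=
  ∃ s : Finset G, TopGenerates s

/-- `d(G)`, the minimal number of topological generators of `G`. It is meaningful when `G` is
topologically finitely generated; this is inherited by open subgroups. -/
noncomputable def topRank (G : Type*) [Group G] [TopologicalSpace G] : ℕ :=
  sInf {n : ℕ | ∃ s : Finset G, s.card = n ∧ TopGenerates s}

/-- The (absolute) rank gradient of `G`: the infimum of `(d(U) - 1) / |G : U|` over all open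
subgroups `U` of `G`. The values are bounded below by `-1`. -/
noncomputable def rankGradient (G : Type*) [Group G] [TopologicalSpace G] : ℝ :=
  sInf {x : ℝ | ∃ U : Subgroup G, IsOpen (U : Set G) ∧ x = ((topRank U : ℝ) - 1) / (U.index : ℝ)}

/-- The Frattini series of `G`: `Φ₀(G) = G`, and `Φᵢ₊₁(G)` is the closed subgroup generated by
the commutators and the `p`-th powers of elements of `Φᵢ(G)`. -/
def frattiniSeries (p : ℕ) (G : Type*) [Group G] [TopologicalSpace G] [IsTopologicalGroup G] :
    ℕ → Subgroup G
  | 0 => ⊤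
  | i + 1 =>
    (⁅frattiniSeries p G i, frattiniSeries p G i⁆ ⊔
      Subgroup.closure ((fun x : G => x ^ p) '' (frattiniSeries p G i : Set G))).topologicalClosure

/-- The distance function of a series `S : G₀ ≥ G₁ ≥ …` of subgroups:
`d(x, y) = inf {|G : Gᵢ|⁻¹ | x⁻¹ y ∈ Gᵢ}`. -/
noncomputable def seriesDist {G : Type*} [Group G] (S : ℕ → Subgroup G) (x y : G) : ℝ :=
  sInf {d : ℝ | ∃ i : ℕ, x⁻¹ * y ∈ S i ∧ d = ((S i).index : ℝ)⁻¹}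

/-- The Hausdorff dimension of a subgroup `K` as a lower limit of logarithmic densities:
`liminf log_p |K : K ∩ Gᵢ| / log_p |G : Gᵢ|`. -/
noncomputable def subgroupHDim {G : Type*} [Group G] (p : ℕ) (S : ℕ → Subgroup G)
    (K : Subgroup G) : ℝ :=
  Filter.liminf
    (fun i : ℕ => Real.logb p ((S i).relIndex K : ℝ) / Real.logb p ((S i).index : ℝ))
    Filter.atTop

/-- The Hausdorff spectrum of `G` with respect to `S`: the Hausdorff dimensions of all closed
subgroups. -/
def hausdorffSpectrum {G : Type*} [Group G] [TopologicalSpace G] (p : ℕ)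
    (S : ℕ → Subgroup G) : Set ℝ :=
  {t : ℝ | ∃ K : Subgroup G, IsClosed (K : Set G) ∧ subgroupHDim p S K = t}

/-- The metric Hausdorff dimension of `A ⊆ X` for an explicitly given metric `m` on `X`. -/
noncomputable def metricHDim {X : Type*} (m : MetricSpace X) (A : Set X) : ENNReal :=
  @dimH X m.toEMetricSpace A

/-!
# Frattini series and Hausdorff spectra of products of groups of positive rank gradient

Let `H` be a finitely generated pro-`p` group, `Φᵢ` its Frattini series and `ℓ i` the logarithm to
base `p` of `|H : Φᵢ|`. Generators of `Φᵢ` modulo `Φᵢ₊₁` generate `Φᵢ` topologically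
(`topRank_frattiniSeries_le`), so positive rank gradient gives `ℓ (i + 1) - ℓ i ≥ 1 + ρ p ^ ℓ i`
for some `ρ > 0` (`exists_index_frattiniSeries_eq_pow`): each layer is exponentially large compared
with everything before it.

This leaves enough room to build closed subgroups of every density `0 < α < 1` from above. Suppose
that `M ≥ Φᵢ` satisfies `|M : Φᵢ| = p ^ l` with `l = ⌊α ℓ i⌋`. Lifting `l` generators of `M / Φᵢ`
and applying Schreier's index formula gives a supplement of `Φᵢ / Φᵢ₊₁` in `M / Φᵢ₊₁` of order at
most `p ^ (l + l p ^ l)` (`exists_supplement_card_le`). As `α < 1`, the exponent is eventually less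
than `⌊α ℓ (i + 1)⌋`, because `p ^ (α ℓ i)` is negligible compared with `p ^ ℓ i`; and in a finite
`p`-group a subgroup can be enlarged to any admissible order. So there is `M' ≥ Φᵢ₊₁` with
`M' Φᵢ = M` and `|M' : Φᵢ₊₁| = p ^ ⌊α ℓ (i + 1)⌋`. By compactness the intersection `K` of such a
sequence satisfies `|K : K ∩ Φᵢ| = p ^ ⌊α ℓ i⌋` for all large `i`
(`exists_isClosed_relIndex_frattiniSeries_eq`). For a product, the Frattini series is the product of
the Frattini series (`frattiniSeries_pi`), logarithmic indices add up, and the product of subgroups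
of density `α` in the factors has density `α` (`subgroupHDim_pi_eq`). The density is a limit in
every factor, not just a lower limit, which is what makes the densities of the factors combine.

The formula for the Hausdorff dimension holds for any filtration series (`IsFiltrationSeries`). The
cosets of its `i`-th term are the closed balls of radius `|G : Gᵢ|⁻¹`. Covering `K` by these cosets
gives the upper bound (`IsFiltrationSeries.dimH_le`), and the mass distribution principle for the
Haar measure of `K` gives the lower bound (`IsFiltrationSeries.le_dimH`).
-/

/-! ### Finite `p`-groups -/

/-- A finite group of order `p ^ k` is generated by at most `k` elements. -/
theorem exists_finset_card_le_closure_eq_top {p k : ℕ} [Fact p.Prime] {P : Type*} [Group P]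
    [Finite P] (hP : Nat.card P = p ^ k) :
    ∃ s : Finset P, s.card ≤ k ∧ Subgroup.closure (s : Set P) = ⊤ := by
  classical
  have hp : p.Prime := Fact.out
  have key : ∀ n : ℕ, ∃ s : Finset P, s.card ≤ n ∧
      (Subgroup.closure (s : Set P) = ⊤ ∨ p ^ n ≤ Nat.card (Subgroup.closure (s : Set P))) := by
    intro n
    induction n with
    | zero => exact ⟨∅, by simp, Or.inr (by simp)⟩
    | succ n ih =>
      obtain ⟨s, hs, h | h⟩ := ih
      · exact ⟨s, by omega, Or.inl h⟩
      · by_cases ht : Subgroup.closure (s : Set P) = ⊤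
        · exact ⟨s, by omega, Or.inl ht⟩
        obtain ⟨x, hx⟩ : ∃ x, x ∉ Subgroup.closure (s : Set P) := by
          by_contra! hc
          exact ht (eq_top_iff.2 fun x _ => hc x)
        refine ⟨insert x s, (Finset.card_insert_le _ _).trans (by omega), Or.inr ?_⟩
        have hle : Subgroup.closure (s : Set P) ≤
            Subgroup.closure ((insert x s : Finset P) : Set P) :=
          Subgroup.closure_mono (by simp)
        have hmul := Subgroup.relIndex_mul_relIndex ⊥ _ _ bot_le hle
        rw [Subgroup.relIndex_bot_left, Subgroup.relIndex_bot_left, mul_comm] at hmul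
        have hne : (Subgroup.closure (s : Set P)).relIndex
            (Subgroup.closure ((insert x s : Finset P) : Set P)) ≠ 1 := fun h1 =>
          hx (Subgroup.relIndex_eq_one.1 h1 (Subgroup.subset_closure (by simp)))
        have hdvd : (Subgroup.closure (s : Set P)).relIndex
            (Subgroup.closure ((insert x s : Finset P) : Set P)) ∣ p ^ k :=
          hP ▸ (Subgroup.relIndex_dvd_card _ _).trans (Subgroup.card_subgroup_dvd_card _)
        obtain ⟨j, -, hj⟩ := (Nat.dvd_prime_pow hp).1 hdvd
        have hpj : p ≤ (Subgroup.closure (s : Set P)).relIndex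
            (Subgroup.closure ((insert x s : Finset P) : Set P)) := by
          rw [hj] at hne ⊢
          exact Nat.le_self_pow (by rintro rfl; simp at hne) p
        rw [← hmul, pow_succ']
        exact Nat.mul_le_mul hpj h
  obtain ⟨s, hs, h | h⟩ := key k
  · exact ⟨s, hs, h⟩
  · exact ⟨s, hs, Subgroup.eq_top_of_le_card _ (hP ▸ h)⟩

/-- Generators of a quotient of order `p ^ l` lift to `l` elements generating modulo the kernel. -/
theorem exists_finset_card_le_closure_sup_eq_top {p l : ℕ} [Fact p.Prime] {P : Type*} [Group P]
    {A : Subgroup P} [A.Normal] (hA : A.index = p ^ l) :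
    ∃ t : Finset P, t.card ≤ l ∧ Subgroup.closure (t : Set P) ⊔ A = ⊤ := by
  classical
  have hp : p.Prime := Fact.out
  have : Finite (P ⧸ A) :=
    Nat.finite_of_card_ne_zero (A.index_eq_card ▸ hA ▸ (pow_pos hp.pos _).ne')
  obtain ⟨s, hs, hgen⟩ := exists_finset_card_le_closure_eq_top (P := P ⧸ A) (k := l) (p := p) hA
  refine ⟨s.image Quotient.out, Finset.card_image_le.trans hs, ?_⟩
  have hout : ⇑(QuotientGroup.mk' A) ∘ Quotient.out = id := funext fun x => Quotient.out_eq' x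
  have hmap : (Subgroup.closure ((s.image Quotient.out : Finset P) : Set P)).map
      (QuotientGroup.mk' A) = ⊤ := by
    rw [MonoidHom.map_closure, Finset.coe_image, ← Set.image_comp, hout, Set.image_id, hgen]
  have := Subgroup.comap_map_eq (QuotientGroup.mk' A)
    (Subgroup.closure ((s.image Quotient.out : Finset P) : Set P))
  rw [hmap, Subgroup.comap_top, QuotientGroup.ker_mk'] at this
  exact this.symm

/-- In a finite `p`-group, commutators and `p`-th powers are non-generators: every proper subgroup
lies in a normal subgroup of index `p`. -/
theorem eq_top_of_sup_commutator_sup_pow_eq_top {p : ℕ} [Fact p.Prime] {P : Type*} [Group P]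
    [Finite P] (hP : IsPGroup p P) {M : Subgroup P}
    (h : M ⊔ (⁅(⊤ : Subgroup P), ⊤⁆ ⊔ Subgroup.closure ((fun x : P => x ^ p) '' Set.univ)) = ⊤) :
    M = ⊤ := by
  have hp : p.Prime := Fact.out
  by_contra hM
  obtain ⟨k, hk⟩ := IsPGroup.iff_card.1 hP
  obtain ⟨n, hn⟩ := IsPGroup.iff_card.1 (hP.to_subgroup M)
  have hnk : n < k := by
    by_contra! hc
    exact hM (Subgroup.eq_top_of_le_card _ (by
      rw [hk, hn]; exact Nat.pow_le_pow_right hp.pos hc))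
  obtain ⟨L, hL, hML⟩ := Sylow.exists_subgroup_card_pow_prime_le p (m := k - 1)
    (hk ▸ pow_dvd_pow p (by omega)) M hn (by omega)
  have hidx : L.index = p := by
    have := L.index_mul_card
    rw [hL, hk] at this
    have h2 : p ^ k = p * p ^ (k - 1) := by rw [← pow_succ']; congr 1; omega
    rw [h2] at this
    exact Nat.eq_of_mul_eq_mul_right (pow_pos hp.pos _) this
  have hnorm : L.Normal := Subgroup.normal_of_index_eq_minFac_card (by
    rw [hidx, hk, hp.pow_minFac (by omega)])
  have hq : Nat.card (P ⧸ L) = p := hidx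
  have hcyc : IsCyclic (P ⧸ L) := isCyclic_of_prime_card hq
  have hcomm : ⁅(⊤ : Subgroup P), ⊤⁆ ≤ L :=
    Subgroup.Normal.quotient_commutative_iff_commutator_le.1
      IsCyclic.isMulCommutative
  have hpow : Subgroup.closure ((fun x : P => x ^ p) '' Set.univ) ≤ L := by
    rw [Subgroup.closure_le]
    rintro _ ⟨x, -, rfl⟩
    rw [SetLike.mem_coe, ← QuotientGroup.eq_one_iff]
    rw [QuotientGroup.mk_pow, ← hq]
    exact pow_card_eq_one'
  have : L = ⊤ := top_le_iff.1 (h ▸ sup_le hML (sup_le hcomm hpow))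
  rw [this, Subgroup.index_top] at hidx
  exact hp.one_lt.ne hidx

/-- The same for a subgroup `U`, inside an ambient finite `p`-group. -/
theorem le_of_le_sup_commutator_sup_pow {p : ℕ} [Fact p.Prime] {Q : Type*} [Group Q]
    [Finite Q] (hQ : IsPGroup p Q) {U M : Subgroup Q} (hMU : M ≤ U)
    (h : U ≤ M ⊔ (⁅U, U⁆ ⊔ Subgroup.closure ((fun x : Q => x ^ p) '' (U : Set Q)))) :
    U ≤ M := by
  rw [← Subgroup.subgroupOf_eq_top]
  refine eq_top_of_sup_commutator_sup_pow_eq_top (hQ.to_subgroup U)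
    (Subgroup.map_injective U.subtype_injective ?_)
  rw [Subgroup.map_sup, Subgroup.map_sup, Subgroup.map_commutator, MonoidHom.map_closure,
    Subgroup.subgroupOf_map_subtype, inf_eq_left.2 hMU]
  have h1 : Subgroup.map U.subtype ⊤ = U := by
    rw [← MonoidHom.range_eq_map, Subgroup.range_subtype]
  have h2 : U.subtype '' ((fun x : U => x ^ p) '' Set.univ) =
      (fun x : Q => x ^ p) '' (U : Set Q) := by
    ext y
    simp only [Set.image_univ, Set.mem_image, Set.mem_range, SetLike.mem_coe]
    exact ⟨by rintro ⟨_, ⟨x, rfl⟩, rfl⟩; exact ⟨x, x.2, rfl⟩,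
      by rintro ⟨x, hx, rfl⟩; exact ⟨_, ⟨⟨x, hx⟩, rfl⟩, rfl⟩⟩
  rw [h1, h2]
  refine le_antisymm (sup_le hMU (sup_le (Subgroup.commutator_le.2 fun a ha b hb => ?_) ?_)) h
  · exact U.mul_mem (U.mul_mem (U.mul_mem ha hb) (U.inv_mem ha)) (U.inv_mem hb)
  rw [Subgroup.closure_le]
  rintro _ ⟨x, hx, rfl⟩
  exact U.pow_mem hx p

/-- A quotient of order `p ^ l` by an elementary abelian normal subgroup `A` has a small
supplement: lift `l` generators of the quotient, and bound the intersection with `A` by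
Schreier's index formula. -/
theorem exists_supplement_card_le {p l : ℕ} [Fact p.Prime] {P : Type*} [Group P]
    [Finite P] {A : Subgroup P} [A.Normal] (hcomm : ⁅A, A⁆ = ⊥)
    (hpow : ∀ a ∈ A, a ^ p = 1) (hA : A.index = p ^ l) :
    ∃ T : Subgroup P, T ⊔ A = ⊤ ∧ Nat.card T ∣ p ^ (l + l * p ^ l) := by
  obtain ⟨t, ht, hTA⟩ := exists_finset_card_le_closure_sup_eq_top hA
  set T : Subgroup P := Subgroup.closure (t : Set P) with hT
  refine ⟨T, hTA, ?_⟩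
  have hidx : (A.subgroupOf T).index = p ^ l := by
    change A.relIndex T = _
    rw [← Subgroup.relIndex_sup_right, hTA, Subgroup.relIndex_top_right, hA]
  have hrank : Group.rank T ≤ l :=
    (Subgroup.rank_closure_finset_le_card t).trans ht
  set E := A.subgroupOf T with hE
  let _ : CommGroup E := { (inferInstance : Group E) with
    mul_comm := fun a b => by
      have hab : ((a : T) : P) * ((b : T) : P) = ((b : T) : P) * ((a : T) : P) := by
        have := Subgroup.commutator_mem_commutator (Subgroup.mem_subgroupOf.1 a.2)
          (Subgroup.mem_subgroupOf.1 b.2)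
        rw [hcomm, Subgroup.mem_bot, commutatorElement_eq_one_iff_mul_comm] at this
        exact this
      exact Subtype.ext (Subtype.ext hab) }
  have hErank : Group.rank E ≤ p ^ l * l := by
    calc Group.rank E ≤ E.index * Group.rank T := Subgroup.rank_le_index_mul_rank E
      _ ≤ p ^ l * l := by rw [hidx]; exact Nat.mul_le_mul_left _ hrank
  have hEcard : Nat.card E ∣ p ^ (l * p ^ l) := by
    refine (card_dvd_exponent_pow_rank' E (n := p) fun a => ?_).trans
      (pow_dvd_pow p (by rw [mul_comm]; exact hErank))
    exact Subtype.ext (Subtype.ext (hpow _ (Subgroup.mem_subgroupOf.1 a.2)))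
  rw [← E.index_mul_card, hidx, pow_add]
  exact mul_dvd_mul_left _ hEcard

/-- Enlarging a small supplement inside the `p`-group gives supplements of every larger order. -/
theorem exists_supplement_card_eq {p l k : ℕ} [Fact p.Prime] {P : Type*} [Group P]
    [Finite P] {A : Subgroup P} [A.Normal] (hcomm : ⁅A, A⁆ = ⊥)
    (hpow : ∀ a ∈ A, a ^ p = 1) (hA : A.index = p ^ l) (hk : l + l * p ^ l ≤ k)
    (hkP : p ^ k ∣ Nat.card P) :
    ∃ T : Subgroup P, T ⊔ A = ⊤ ∧ Nat.card T = p ^ k := by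
  have hp : p.Prime := Fact.out
  obtain ⟨T, hTA, hT⟩ := exists_supplement_card_le hcomm hpow hA
  obtain ⟨n, hn, hTn⟩ := (Nat.dvd_prime_pow hp).1 hT
  obtain ⟨K, hK, hTK⟩ := Sylow.exists_subgroup_card_pow_prime_le p hkP T hTn (hn.trans hk)
  exact ⟨K, top_le_iff.1 (hTA ▸ sup_le_sup_right hTK A), hK⟩

/-- The relative form: between normal subgroups `B ≤ A` with elementary abelian quotient and a
subgroup `M ≥ A`, there are supplements of `A` in `M` of every relative index `p ^ k` over `B`
that is not too small. -/
theorem exists_le_sup_eq_relIndex_eq {p l d k : ℕ} [Fact p.Prime] {H : Type*} [Group H]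
    {A B M : Subgroup H} [A.Normal] [B.Normal] (hBA : B ≤ A) (hAM : A ≤ M)
    (hcomm : ⁅A, A⁆ ≤ B) (hpow : ∀ a ∈ A, a ^ p ∈ B) (hA : A.relIndex M = p ^ l)
    (hB : B.relIndex A = p ^ d) (hk : l + l * p ^ l ≤ k) (hkd : k ≤ l + d) :
    ∃ L : Subgroup H, B ≤ L ∧ L ⊔ A = M ∧ B.relIndex L = p ^ k := by
  have hp : p.Prime := Fact.out
  have hBM : B ≤ M := hBA.trans hAM
  have hBMi : B.relIndex M = p ^ (l + d) := by
    rw [← Subgroup.relIndex_mul_relIndex B A M hBA hAM, hA, hB, pow_add, mul_comm]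
  set f : M →* M ⧸ B.subgroupOf M := QuotientGroup.mk' (B.subgroupOf M) with hf
  have hfs : Function.Surjective f := QuotientGroup.mk'_surjective _
  have hker : f.ker = B.subgroupOf M := QuotientGroup.ker_mk' _
  have hcard : Nat.card (M ⧸ B.subgroupOf M) = p ^ (l + d) := hBMi
  have : Finite (M ⧸ B.subgroupOf M) :=
    Nat.finite_of_card_ne_zero (hcard ▸ (pow_pos hp.pos _).ne')
  have hAker : f.ker ≤ A.subgroupOf M := by
    rw [hker]
    exact Subgroup.comap_mono hBA
  have hAn : ((A.subgroupOf M).map f).Normal := Subgroup.Normal.map inferInstance f hfs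
  obtain ⟨T, hTA, hT⟩ := exists_supplement_card_eq (p := p) (l := l) (k := k)
    (A := (A.subgroupOf M).map f)
    (by
      rw [← Subgroup.map_commutator, Subgroup.map_eq_bot_iff, hker, Subgroup.commutator_le]
      intro a ha b hb
      exact hcomm (Subgroup.commutator_mem_commutator ha hb))
    (by
      rintro _ ⟨a, ha, rfl⟩
      rw [← map_pow, ← MonoidHom.mem_ker, hker]
      exact hpow _ ha)
    (by rw [Subgroup.index_map_eq _ hfs hAker]; exact hA) hk
    (hcard ▸ pow_dvd_pow p hkd)
  have hBmap : (B.subgroupOf M).map M.subtype = B := by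
    rw [Subgroup.subgroupOf_map_subtype, inf_eq_left.2 hBM]
  have hAmap : (A.subgroupOf M).map M.subtype = A := by
    rw [Subgroup.subgroupOf_map_subtype, inf_eq_left.2 hAM]
  refine ⟨(T.comap f).map M.subtype, ?_, ?_, ?_⟩
  · nth_rewrite 1 [← hBmap]
    refine Subgroup.map_mono ?_
    exact hker.symm.le.trans (MonoidHom.ker_le_comap f T)
  · have : T.comap f ⊔ A.subgroupOf M = ⊤ := by
      have h1 : (T.comap f ⊔ A.subgroupOf M).map f = ⊤ := by
        rw [Subgroup.map_sup, Subgroup.map_comap_eq_self_of_surjective hfs, hTA]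
      have h2 := Subgroup.comap_map_eq_self (f := f) (H := T.comap f ⊔ A.subgroupOf M)
        (hAker.trans le_sup_right)
      rw [h1, Subgroup.comap_top] at h2
      exact h2.symm
    calc (T.comap f).map M.subtype ⊔ A
        = (T.comap f).map M.subtype ⊔ (A.subgroupOf M).map M.subtype := by rw [hAmap]
      _ = M := by
        rw [← Subgroup.map_sup, this, ← MonoidHom.range_eq_map, Subgroup.range_subtype]
  · nth_rewrite 1 [← hBmap]
    have h := Subgroup.relIndex_ker (K := T.comap f) f
    rw [hker, Subgroup.map_comap_eq_self_of_surjective hfs, hT] at h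
    rw [Subgroup.relIndex_map_map_of_injective _ _ M.subtype_injective, h]

/-! ### The Frattini series of a topological group -/

section FrattiniSeries

variable {p : ℕ} {G : Type*} [Group G] [TopologicalSpace G] [IsTopologicalGroup G]

theorem commutator_frattiniSeries_le (i : ℕ) :
    ⁅frattiniSeries p G i, frattiniSeries p G i⁆ ≤ frattiniSeries p G (i + 1) :=
  le_sup_left.trans (Subgroup.le_topologicalClosure _)

theorem pow_mem_frattiniSeries_succ {i : ℕ} {x : G} (hx : x ∈ frattiniSeries p G i) :
    x ^ p ∈ frattiniSeries p G (i + 1) :=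
  Subgroup.le_topologicalClosure _
    (Subgroup.mem_sup_right (Subgroup.subset_closure ⟨x, hx, rfl⟩))

theorem isClosed_frattiniSeries (i : ℕ) : IsClosed (frattiniSeries p G i : Set G) := by
  cases i with
  | zero => exact isClosed_univ
  | succ i => exact Subgroup.isClosed_topologicalClosure _

theorem frattiniSeries_succ_le_of_isClosed {i : ℕ} {L : Subgroup G} (hL : IsClosed (L : Set G))
    (hcomm : ⁅frattiniSeries p G i, frattiniSeries p G i⁆ ≤ L)
    (hpow : ∀ x ∈ frattiniSeries p G i, x ^ p ∈ L) : frattiniSeries p G (i + 1) ≤ L := by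
  refine Subgroup.topologicalClosure_minimal _ (sup_le hcomm ?_) hL
  rw [Subgroup.closure_le]
  rintro _ ⟨x, hx, rfl⟩
  exact hpow x hx

theorem antitone_frattiniSeries : Antitone (frattiniSeries p G) :=
  antitone_nat_of_succ_le fun i =>
    frattiniSeries_succ_le_of_isClosed (isClosed_frattiniSeries i)
      (Subgroup.commutator_le.2 fun _ ha _ hb =>
        mul_mem (mul_mem (mul_mem ha hb) (inv_mem ha)) (inv_mem hb))
      fun _ hx => pow_mem hx p

/-- The Frattini series is functorial for continuous homomorphisms. -/
theorem frattiniSeries_le_comap {G' : Type*} [Group G'] [TopologicalSpace G']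
    [IsTopologicalGroup G'] (f : G →* G') (hf : Continuous f) (i : ℕ) :
    frattiniSeries p G i ≤ (frattiniSeries p G' i).comap f := by
  induction i with
  | zero => exact le_top
  | succ i ih =>
    refine frattiniSeries_succ_le_of_isClosed ((isClosed_frattiniSeries (i + 1)).preimage hf)
      ?_ fun x hx => ?_
    · rw [Subgroup.commutator_le]
      intro a ha b hb
      rw [Subgroup.mem_comap, map_commutatorElement]
      exact commutator_frattiniSeries_le i (Subgroup.commutator_mem_commutator (ih ha) (ih hb))
    · rw [Subgroup.mem_comap, map_pow]
      exact pow_mem_frattiniSeries_succ (ih hx)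

instance normal_frattiniSeries (i : ℕ) : (frattiniSeries p G i).Normal :=
  ⟨fun _ hx g => frattiniSeries_le_comap (MulAut.conj g).toMonoidHom
    ((continuous_const_mul g).mul continuous_const) i hx⟩

/-- The Frattini series of a finite product is the product of the Frattini series: both inclusions
are instances of functoriality, for the projections and for the inclusions of the factors. -/
theorem frattiniSeries_pi {ι : Type*} [Finite ι] {H : ι → Type*} [∀ j, Group (H j)]
    [∀ j, TopologicalSpace (H j)] [∀ j, IsTopologicalGroup (H j)] (i : ℕ) :
    frattiniSeries p (∀ j, H j) i = Subgroup.pi Set.univ fun j => frattiniSeries p (H j) i := by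
  classical
  refine le_antisymm (Subgroup.le_pi_iff.2 fun j _ =>
    frattiniSeries_le_comap (Pi.evalMonoidHom H j) (continuous_apply j) i)
    (Subgroup.pi_le_iff.2 fun j => Subgroup.map_le_iff_le_comap.2 ?_)
  exact frattiniSeries_le_comap (MonoidHom.mulSingle H j) (continuous_mulSingle j) i

end FrattiniSeries

/-! ### Finitely generated pro-`p` groups -/

/-- Schreier's lemma for topological generators. -/
theorem exists_finset_subset_closure_of_isOpen {G : Type*} [Group G] [TopologicalSpace G]
    [IsTopologicalGroup G] [CompactSpace G] (hfg : IsTopFG G) {U : Subgroup G}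
    (hU : IsOpen (U : Set G)) :
    ∃ t : Finset G, (t : Set G) ⊆ U ∧
      (U : Set G) ⊆ closure (Subgroup.closure (t : Set G) : Set G) := by
  obtain ⟨s, hs⟩ := hfg
  have : Finite (G ⧸ U) := U.quotient_finite_of_isOpen hU
  have : U.FiniteIndex := Subgroup.finiteIndex_of_finite_quotient
  set D := Subgroup.closure (s : Set G) with hD
  have hfg' : Group.FG (U.subgroupOf D) := Subgroup.fg_of_index_ne_zero _
  have hfg2 : (U ⊓ D).FG := by
    rw [← Subgroup.subgroupOf_map_subtype]
    exact (Group.fg_iff_subgroup_fg _).1 (Group.fg_of_surjective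
      (D.subtype.subgroupMap_surjective (U.subgroupOf D)))
  obtain ⟨t, ht⟩ := hfg2
  refine ⟨t, ?_, ?_⟩
  · exact Subgroup.subset_closure.trans ((ht.le.trans inf_le_left : _ ≤ U))
  · rw [ht, Subgroup.coe_inf]
    exact Dense.open_subset_closure_inter hs hU

section ProP

variable {p : ℕ} [Fact p.Prime] {H : Type*} [Group H] [TopologicalSpace H] [IsTopologicalGroup H]

/-- Every term of the Frattini series of a finitely generated profinite group is open: by
induction it is topologically finitely generated, so its quotient by the next term is the closure
of a finitely generated abelian group of exponent `p`, hence finite. -/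
theorem isOpen_frattiniSeries [CompactSpace H] (hfg : IsTopFG H) (i : ℕ) :
    IsOpen (frattiniSeries p H i : Set H) := by
  have hp : p.Prime := Fact.out
  induction i with
  | zero => exact isOpen_univ
  | succ i ih =>
    obtain ⟨t, htU, hUt⟩ := exists_finset_subset_closure_of_isOpen hfg ih
    set A := frattiniSeries p H i with hA
    set B := frattiniSeries p H (i + 1) with hB
    have hBcl : IsClosed (B : Set H) := isClosed_frattiniSeries (i + 1)
    have hBA : B ≤ A := antitone_frattiniSeries (Nat.le_succ i)
    have hcommA : ∀ x ∈ A, ∀ y ∈ A, (x : H ⧸ B) * y = y * x := by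
      intro x hx y hy
      rw [← commutatorElement_eq_one_iff_mul_comm]
      have h1 := map_commutatorElement (QuotientGroup.mk' B) x y
      exact h1.symm.trans ((QuotientGroup.eq_one_iff _).2
        (commutator_frattiniSeries_le i (Subgroup.commutator_mem_commutator hx hy)))
    set D : Subgroup (H ⧸ B) := (Subgroup.closure (t : Set H)).map (QuotientGroup.mk' B) with hD
    have hclA : Subgroup.closure (t : Set H) ≤ A := (Subgroup.closure_le _).2 htU
    have hDfg : Group.FG D :=
      Group.fg_of_surjective
        ((QuotientGroup.mk' B).subgroupMap_surjective (Subgroup.closure (t : Set H)))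
    let _ : CommGroup D := { (inferInstance : Group D) with
      mul_comm := by
        rintro ⟨_, x, hx, rfl⟩ ⟨_, y, hy, rfl⟩
        exact Subtype.ext (hcommA x (hclA hx) y (hclA hy)) }
    have hDtor : IsMulTorsion D := by
      rintro ⟨_, x, hx, rfl⟩
      exact isOfFinOrder_iff_pow_eq_one.2 ⟨p, hp.pos, Subtype.ext
        ((QuotientGroup.eq_one_iff _).2 (pow_mem_frattiniSeries_succ (hclA hx)))⟩
    have hDfin : Finite D := CommGroup.finite_of_fg_isMulTorsion D hDtor
    have hDcl : IsClosed (D : Set (H ⧸ B)) := (Set.toFinite (D : Set (H ⧸ B))).isClosed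
    have hAD : A.map (QuotientGroup.mk' B) ≤ D := by
      rw [Subgroup.map_le_iff_le_comap]
      have hcl : IsClosed ((D.comap (QuotientGroup.mk' B) : Subgroup H) : Set H) :=
        hDcl.preimage QuotientGroup.continuous_mk
      exact hUt.trans (closure_minimal (Subgroup.le_comap_map _ _) hcl)
    have hfinA : Finite (A.map (QuotientGroup.mk' B)) :=
      Set.Finite.subset (Set.toFinite (D : Set (H ⧸ B))) hAD
    have hrel : B.relIndex A ≠ 0 := by
      have h1 := Subgroup.relIndex_ker (K := A) (QuotientGroup.mk' B)
      rw [QuotientGroup.ker_mk'] at h1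
      rw [h1]
      exact Nat.card_pos.ne'
    have : Finite (H ⧸ A) := A.quotient_finite_of_isOpen ih
    have : B.FiniteIndex := ⟨by
      rw [← Subgroup.relIndex_mul_index hBA]
      exact mul_ne_zero hrel Subgroup.index_ne_zero_of_finite⟩
    exact B.isOpen_of_isClosed_of_finiteIndex hBcl

/-- Elements of the next term are non-generators: modulo an open normal subgroup, a subgroup
generating a term of the Frattini series together with the next term is the whole term. -/
theorem frattiniSeries_le_sup_of_le_sup (hH : IsProP p H) {i : ℕ} {M N : Subgroup H} [N.Normal]
    (hN : IsOpen (N : Set H)) (hM : M ≤ frattiniSeries p H i)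
    (h : frattiniSeries p H i ≤ M ⊔ frattiniSeries p H (i + 1) ⊔ N) :
    frattiniSeries p H i ≤ M ⊔ N := by
  have := hH.compact
  have : Finite (H ⧸ N) := N.quotient_finite_of_isOpen hN
  obtain ⟨k, hk⟩ := hH.index_eq N inferInstance hN
  have hQ : IsPGroup p (H ⧸ N) := IsPGroup.of_card (n := k) hk
  set U := frattiniSeries p H i with hU
  set π := QuotientGroup.mk' N with hπ
  have hker : π.ker = N := QuotientGroup.ker_mk' N
  have hF : frattiniSeries p H (i + 1) ≤
      (⁅U.map π, U.map π⁆ ⊔ Subgroup.closure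
        ((fun x : H ⧸ N => x ^ p) '' (U.map π : Set (H ⧸ N)))).comap π := by
    refine frattiniSeries_succ_le_of_isClosed ?_ ?_ ?_
    · exact Subgroup.isClosed_of_isOpen _
        (Subgroup.isOpen_mono (hker.symm.le.trans (MonoidHom.ker_le_comap _ _)) hN)
    · rw [← Subgroup.map_le_iff_le_comap, Subgroup.map_commutator]
      exact le_sup_left
    · intro x hx
      rw [Subgroup.mem_comap, map_pow]
      exact Subgroup.mem_sup_right (Subgroup.subset_closure ⟨π x, ⟨x, hx, rfl⟩, rfl⟩)
  have key : U.map π ≤ M.map π := by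
    refine le_of_le_sup_commutator_sup_pow hQ (Subgroup.map_mono hM) ?_
    refine (Subgroup.map_mono h).trans ?_
    rw [Subgroup.map_sup, Subgroup.map_sup]
    refine sup_le (sup_le le_sup_left ((Subgroup.map_le_iff_le_comap.2 hF).trans le_sup_right)) ?_
    rw [(Subgroup.map_eq_bot_iff _).2 hker.symm.le]
    exact bot_le
  rw [Subgroup.map_le_iff_le_comap, Subgroup.comap_map_eq, hker] at key
  exact key

/-- The Frattini series of a pro-`p` group reaches every open normal subgroup `N`: modulo `N` it
descends strictly until it is trivial. -/
theorem exists_frattiniSeries_le (hH : IsProP p H) {N : Subgroup H} [N.Normal]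
    (hN : IsOpen (N : Set H)) : ∃ i, frattiniSeries p H i ≤ N := by
  by_contra! hc
  have := hH.compact
  have : Finite (H ⧸ N) := N.quotient_finite_of_isOpen hN
  have hNfi : N.FiniteIndex := Subgroup.finiteIndex_of_finite_quotient
  have hfi : ∀ i, (frattiniSeries p H i ⊔ N).FiniteIndex := fun i =>
    Subgroup.finiteIndex_of_le le_sup_right
  have hmono : StrictMono fun i => (frattiniSeries p H i ⊔ N).index := by
    refine strictMono_nat_of_lt_succ fun i => ?_
    have hle : frattiniSeries p H (i + 1) ⊔ N ≤ frattiniSeries p H i ⊔ N :=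
      sup_le_sup_right (antitone_frattiniSeries (Nat.le_succ i)) N
    refine Subgroup.index_strictAnti (lt_of_le_of_ne hle fun heq => hc i ?_)
    have := frattiniSeries_le_sup_of_le_sup hH (M := ⊥) (i := i) hN bot_le
      (by rw [bot_sup_eq, heq]; exact le_sup_left)
    rwa [bot_sup_eq] at this
  have h1 := hmono.id_le (N.index + 1)
  have h2 : (frattiniSeries p H (N.index + 1) ⊔ N).index ≤ N.index :=
    Subgroup.index_antitone le_sup_right
  simp only [id] at h1
  omega

theorem exists_frattiniSeries_subset (hH : IsProP p H) {W : Set H} (hW : W ∈ nhds 1) :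
    ∃ i, (frattiniSeries p H i : Set H) ⊆ W := by
  have := hH.compact
  have := hH.totallyDisconnected
  obtain ⟨V, hVW, hV, h1V⟩ := mem_nhds_iff.1 hW
  obtain ⟨N, hNV⟩ := ProfiniteGrp.exist_openNormalSubgroup_sub_open_nhds_of_one hV h1V
  obtain ⟨i, hi⟩ := exists_frattiniSeries_le (p := p) hH (N := N.toSubgroup) N.isOpen'
  exact ⟨i, fun x hx => hVW (hNV (hi hx))⟩

theorem topRank_le_card {G : Type*} [Group G] [TopologicalSpace G] {s : Finset G}
    (hs : TopGenerates s) : topRank G ≤ s.card :=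
  Nat.sInf_le ⟨s, rfl, hs⟩

/-- The inequality half of Burnside's basis theorem: generators of a term of the Frattini series
modulo the next term are topological generators. -/
theorem topRank_frattiniSeries_le (hH : IsProP p H) {i d : ℕ}
    (hd : (frattiniSeries p H (i + 1)).relIndex (frattiniSeries p H i) = p ^ d) :
    topRank (frattiniSeries p H i) ≤ d := by
  have := hH.compact
  have := hH.totallyDisconnected
  set U := frattiniSeries p H i with hU
  set B := frattiniSeries p H (i + 1) with hB
  have hBU : B ≤ U := antitone_frattiniSeries (Nat.le_succ i)
  obtain ⟨t, ht, htB⟩ := exists_finset_card_le_closure_sup_eq_top (A := B.subgroupOf U) hd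
  suffices hgen : TopGenerates t from (topRank_le_card hgen).trans ht
  set M := (Subgroup.closure (t : Set U)).map U.subtype with hM
  have hMU : M ≤ U := Subgroup.map_subtype_le _
  have hMB : U ≤ M ⊔ B := by
    have h1 := congrArg (Subgroup.map U.subtype) htB
    rw [Subgroup.map_sup, Subgroup.subgroupOf_map_subtype, inf_eq_left.2 hBU,
      ← MonoidHom.range_eq_map, Subgroup.range_subtype] at h1
    exact h1.ge
  refine Subtype.dense_iff.2 fun x hx => mem_closure_iff.2 fun W hW hxW => ?_
  obtain ⟨N, hNW⟩ := ProfiniteGrp.exist_openNormalSubgroup_sub_open_nhds_of_one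
    (hW.preimage (continuous_const_mul x)) (by simpa using hxW)
  have hxMN := frattiniSeries_le_sup_of_le_sup hH (N := N.toSubgroup) N.isOpen' hMU
    (hMB.trans le_sup_left) hx
  obtain ⟨m, hm, n, hn, rfl⟩ := Subgroup.mem_sup_of_normal_right.1 hxMN
  refine ⟨m, ?_, hm⟩
  have := hNW (inv_mem hn : n⁻¹ ∈ N.toSubgroup)
  simpa using this

/-- Positive rank gradient as a uniform lower bound; the values `(d(U) - 1) / |G : U|` are at least
`-1`, so that the infimum is a genuine one. -/
theorem exists_pos_mul_index_le_topRank_sub_one {G : Type*} [Group G] [TopologicalSpace G]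
    (hRG : 0 < rankGradient G) :
    ∃ ρ : ℝ, 0 < ρ ∧ ∀ U : Subgroup G, IsOpen (U : Set G) → U.index ≠ 0 →
      ρ * U.index ≤ (topRank U : ℝ) - 1 := by
  refine ⟨_, hRG, fun U hU h0 => ?_⟩
  have hpos : (0 : ℝ) < U.index := by positivity
  rw [← le_div_iff₀ hpos]
  refine csInf_le ⟨-1, ?_⟩ ⟨U, hU, rfl⟩
  rintro _ ⟨V, -, rfl⟩
  rcases Nat.eq_zero_or_pos V.index with h | h
  · simp [h]
  · have h1 : (1 : ℝ) ≤ V.index := by exact_mod_cast h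
    rw [le_div_iff₀ (by linarith)]
    have : (0 : ℝ) ≤ topRank V := by positivity
    linarith

/-- The logarithmic indices `ℓ i` of the Frattini series of a finitely generated pro-`p` group of
positive rank gradient grow like an iterated exponential: `Φᵢ / Φᵢ₊₁` has order `p ^ d` with
`d ≥ d(Φᵢ) ≥ 1 + ρ |H : Φᵢ|`. -/
theorem exists_index_frattiniSeries_eq_pow (hH : IsProP p H) (hfg : IsTopFG H)
    (hRG : 0 < rankGradient H) :
    ∃ (ρ : ℝ) (ℓ : ℕ → ℕ), 0 < ρ ∧ (∀ i, (frattiniSeries p H i).index = p ^ ℓ i) ∧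
      ∀ i, (ℓ i : ℝ) + 1 + ρ * (p : ℝ) ^ ℓ i ≤ ℓ (i + 1) := by
  have := hH.compact
  have hp : p.Prime := Fact.out
  obtain ⟨ρ, hρ, hU⟩ := exists_pos_mul_index_le_topRank_sub_one hRG
  choose ℓ hℓ using fun i => hH.index_eq _ (normal_frattiniSeries (p := p) i)
    (isOpen_frattiniSeries hfg i)
  refine ⟨ρ, ℓ, hρ, hℓ, fun i => ?_⟩
  have hmul := Subgroup.relIndex_mul_index
    (antitone_frattiniSeries (p := p) (G := H) (Nat.le_succ i))
  rw [hℓ, hℓ] at hmul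
  have hle : ℓ i ≤ ℓ (i + 1) :=
    (Nat.pow_dvd_pow_iff_le_right hp.one_lt).1 (Dvd.intro_left _ hmul)
  have hrel : (frattiniSeries p H (i + 1)).relIndex (frattiniSeries p H i) =
      p ^ (ℓ (i + 1) - ℓ i) := by
    refine Nat.eq_of_mul_eq_mul_right (pow_pos hp.pos (ℓ i)) ?_
    rw [hmul, ← pow_add, Nat.sub_add_cancel hle]
  have h1 : (topRank (frattiniSeries p H i) : ℝ) ≤ (ℓ (i + 1) - ℓ i : ℕ) := by
    exact_mod_cast topRank_frattiniSeries_le hH hrel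
  have h2 := hU (frattiniSeries p H i) (isOpen_frattiniSeries hfg i)
    (by rw [hℓ]; exact (pow_pos hp.pos _).ne')
  rw [hℓ] at h2
  push_cast [Nat.cast_sub hle] at h1 h2
  linarith

end ProP

/-! ### Closed subgroups with prescribed orders modulo the Frattini series -/

/-- The intersection of a descending sequence of open subgroups `M n` of a compact group with
`M (n + 1) * N n = M n`, where `N` is a descending sequence of open normal subgroups, covers every
`M n` modulo `N n`, by compactness. -/
theorem iInf_sup_eq_of_sup_eq {G : Type*} [Group G] [TopologicalSpace G] [IsTopologicalGroup G]
    [CompactSpace G] {N M : ℕ → Subgroup G} [∀ n, (N n).Normal]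
    (hN : ∀ n, IsOpen (N n : Set G)) (hNM : ∀ n, N n ≤ M n) (hNanti : Antitone N)
    (hM : ∀ n, M (n + 1) ⊔ N n = M n) (n : ℕ) : (⨅ j, M j) ⊔ N n = M n := by
  have hManti : Antitone M := antitone_nat_of_succ_le fun n => le_sup_left.trans (hM n).le
  have hMcl : ∀ n, IsClosed (M n : Set G) := fun n =>
    Subgroup.isClosed_of_isOpen _ (Subgroup.isOpen_mono (hNM n) (hN n))
  have hsup : ∀ j, M (n + j) ⊔ N n = M n := by
    intro j
    induction j with
    | zero => exact sup_eq_left.2 (hNM n)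
    | succ j ih =>
      have hle : N (n + j) ≤ N n := hNanti (Nat.le_add_right n j)
      rw [← sup_eq_right.2 hle, ← sup_assoc, ← add_assoc, hM, ih]
  refine le_antisymm (sup_le (iInf_le _ n) (hNM n)) fun x hx => ?_
  obtain ⟨y, hy⟩ := IsCompact.nonempty_iInter_of_sequence_nonempty_isCompact_isClosed
    (fun j => {y : G | y ∈ M (n + j) ∧ x⁻¹ * y ∈ N n})
    (fun j y hy => ⟨hManti (by omega) hy.1, hy.2⟩)
    (fun j => by
      have hxj : x ∈ M (n + j) ⊔ N n := (hsup j).symm ▸ hx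
      obtain ⟨m, hm, k, hk, rfl⟩ := Subgroup.mem_sup_of_normal_right.1 hxj
      exact ⟨m, hm, by simpa using hk⟩)
    ((hMcl _).inter ((Subgroup.isClosed_of_isOpen _ (hN n)).preimage
      (continuous_const_mul x⁻¹))).isCompact
    (fun j => (hMcl _).inter ((Subgroup.isClosed_of_isOpen _ (hN n)).preimage
      (continuous_const_mul x⁻¹)))
  rw [Set.mem_iInter] at hy
  have hyK : y ∈ ⨅ j, M j := by
    rw [Subgroup.mem_iInf]
    exact fun j => hManti (Nat.le_add_left j n) (hy j).1
  have hxy : x = y * (x⁻¹ * y)⁻¹ := by group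
  rw [hxy]
  exact mul_mem (Subgroup.mem_sup_left hyK) (Subgroup.mem_sup_right (inv_mem (hy 0).2))

/-- If `ℓ` grows at least exponentially at each step, then `κ i = ⌊α ℓ i⌋` eventually satisfies the
lower bound for supplements in `exists_isClosed_relIndex_frattiniSeries_eq`, because
`p ^ (α ℓ i)` is negligible compared with `p ^ ℓ i`. -/
theorem eventually_floor_add_floor_mul_pow_le {p : ℕ} {α ρ : ℝ} (hα₀ : 0 < α) (hα₁ : α < 1)
    (hρ : 0 < ρ) (hp : 1 < p) {ℓ : ℕ → ℕ}
    (hℓ : ∀ i, (ℓ i : ℝ) + 1 + ρ * (p : ℝ) ^ ℓ i ≤ ℓ (i + 1)) :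
    ∀ᶠ i in Filter.atTop,
      ⌊α * ℓ i⌋₊ + ⌊α * ℓ i⌋₊ * p ^ ⌊α * ℓ i⌋₊ ≤ ⌊α * ℓ (i + 1)⌋₊ := by
  have hp1 : (1 : ℝ) < p := by exact_mod_cast hp
  have hp0 : (0 : ℝ) < p := by linarith
  have hmono : StrictMono ℓ := strictMono_nat_of_lt_succ fun i => by
    have h1 : (0 : ℝ) < ρ * (p : ℝ) ^ ℓ i := by positivity
    have h2 := hℓ i
    have : (ℓ i : ℝ) < ℓ (i + 1) := by linarith
    exact_mod_cast this
  set r : ℝ := (p : ℝ) ^ (1 - α) with hr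
  have hr1 : 1 < r := Real.one_lt_rpow hp1 (by linarith)
  have hlittle := (isLittleO_pow_const_const_pow_of_one_lt (R := ℝ) 1 hr1).def
    (show 0 < ρ / 2 by positivity)
  filter_upwards [hmono.tendsto_atTop.eventually hlittle] with i hi
  set n := ℓ i with hn
  rw [pow_one, Real.norm_of_nonneg (by positivity), Real.norm_of_nonneg (by positivity)] at hi
  have hfl : (⌊α * n⌋₊ : ℝ) ≤ α * n := Nat.floor_le (by positivity)
  have hpow : (p : ℝ) ^ ⌊α * n⌋₊ ≤ (p : ℝ) ^ (α * n) := by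
    rw [← Real.rpow_natCast]
    exact Real.rpow_le_rpow_of_exponent_le hp1.le hfl
  have hsplit : r ^ n * (p : ℝ) ^ (α * n) = (p : ℝ) ^ n := by
    rw [hr, ← Real.rpow_natCast, ← Real.rpow_mul hp0.le, ← Real.rpow_add hp0, ← Real.rpow_natCast]
    congr 1
    ring
  have h1p : (1 : ℝ) ≤ (p : ℝ) ^ (α * n) := Real.one_le_rpow hp1.le (by positivity)
  refine Nat.le_floor ?_
  push_cast
  calc (⌊α * n⌋₊ : ℝ) + ⌊α * n⌋₊ * (p : ℝ) ^ ⌊α * n⌋₊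
      ≤ α * n * (p : ℝ) ^ (α * n) + α * n * (p : ℝ) ^ (α * n) := by
        refine add_le_add (hfl.trans (le_mul_of_one_le_right (by positivity) h1p)) ?_
        exact mul_le_mul hfl hpow (by positivity) (by positivity)
    _ = α * (2 * n * (p : ℝ) ^ (α * n)) := by ring
    _ ≤ α * (ρ * (r ^ n * (p : ℝ) ^ (α * n))) := by
        refine mul_le_mul_of_nonneg_left ?_ hα₀.le
        rw [← mul_assoc]
        exact mul_le_mul_of_nonneg_right (by linarith) (by positivity)
    _ ≤ α * ℓ (i + 1) := by
        rw [hsplit]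
        refine mul_le_mul_of_nonneg_left ?_ hα₀.le
        have := hℓ i
        have h0 : (0 : ℝ) ≤ n := by positivity
        linarith

section ProP

variable {p : ℕ} [Fact p.Prime] {H : Type*} [Group H] [TopologicalSpace H] [IsTopologicalGroup H]

/-- A sequence of logarithmic orders `κ` is realised by a closed subgroup, modulo the terms of the
Frattini series from `i₀` on, if each step leaves room for a supplement of minimal size and does
not exceed the size of the full preimage. -/
theorem exists_isClosed_relIndex_frattiniSeries_eq [CompactSpace H] (hfg : IsTopFG H)
    {ℓ κ : ℕ → ℕ} {i₀ : ℕ} (hℓ : ∀ i, (frattiniSeries p H i).index = p ^ ℓ i)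
    (h₀ : κ i₀ ≤ ℓ i₀) (hlow : ∀ i, i₀ ≤ i → κ i + κ i * p ^ κ i ≤ κ (i + 1))
    (hup : ∀ i, i₀ ≤ i → κ (i + 1) + ℓ i ≤ κ i + ℓ (i + 1)) :
    ∃ K : Subgroup H, IsClosed (K : Set H) ∧
      ∀ i, i₀ ≤ i → (frattiniSeries p H i).relIndex K = p ^ κ i := by
  have hp : p.Prime := Fact.out
  set Φ := frattiniSeries p H with hΦ
  have hopen : ∀ i, IsOpen (Φ i : Set H) := isOpen_frattiniSeries hfg
  have hanti : Antitone Φ := antitone_frattiniSeries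
  have hℓle : ∀ i, ℓ i ≤ ℓ (i + 1) := fun i => by
    have h1 := Subgroup.index_dvd_of_le (hanti (Nat.le_succ i))
    rw [hℓ, hℓ] at h1
    exact (Nat.pow_dvd_pow_iff_le_right hp.one_lt).1 h1
  have hrel : ∀ i, (Φ (i + 1)).relIndex (Φ i) = p ^ (ℓ (i + 1) - ℓ i) := fun i => by
    have hmul := Subgroup.relIndex_mul_index (hanti (Nat.le_succ i))
    rw [hℓ, hℓ] at hmul
    refine Nat.eq_of_mul_eq_mul_right (pow_pos hp.pos (ℓ i)) ?_
    rw [hmul, ← pow_add, Nat.sub_add_cancel (hℓle i)]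
  have hbase : ∃ M : Subgroup H, Φ i₀ ≤ M ∧ (Φ i₀).relIndex M = p ^ κ i₀ := by
    have hcard : Nat.card (H ⧸ Φ i₀) = p ^ ℓ i₀ := hℓ i₀
    have : Finite (H ⧸ Φ i₀) := (Φ i₀).quotient_finite_of_isOpen (hopen i₀)
    obtain ⟨T, hT⟩ := Sylow.exists_subgroup_card_pow_prime (G := H ⧸ Φ i₀) p
      (hcard ▸ pow_dvd_pow p h₀)
    have hker := QuotientGroup.ker_mk' (Φ i₀)
    refine ⟨T.comap (QuotientGroup.mk' (Φ i₀)),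
      hker.symm.le.trans (MonoidHom.ker_le_comap _ _), ?_⟩
    have h1 := Subgroup.relIndex_ker (K := T.comap (QuotientGroup.mk' (Φ i₀)))
      (QuotientGroup.mk' (Φ i₀))
    rwa [hker, Subgroup.map_comap_eq_self_of_surjective (QuotientGroup.mk'_surjective _), hT]
      at h1
  have hstep : ∀ (n : ℕ) (M : Subgroup H),
      (Φ (i₀ + n) ≤ M ∧ (Φ (i₀ + n)).relIndex M = p ^ κ (i₀ + n)) →
      ∃ L : Subgroup H, (Φ (i₀ + (n + 1)) ≤ L ∧
        (Φ (i₀ + (n + 1))).relIndex L = p ^ κ (i₀ + (n + 1))) ∧ L ⊔ Φ (i₀ + n) = M := by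
    rintro n M ⟨hM, hMi⟩
    have h1 := hup (i₀ + n) (Nat.le_add_right _ _)
    have h2 := hℓle (i₀ + n)
    obtain ⟨L, hL, hLM, hLi⟩ := exists_le_sup_eq_relIndex_eq (hanti (Nat.le_succ (i₀ + n))) hM
      (commutator_frattiniSeries_le _) (fun a ha => pow_mem_frattiniSeries_succ ha) hMi
      (hrel (i₀ + n)) (hlow (i₀ + n) (Nat.le_add_right _ _)) (by omega)
    exact ⟨L, ⟨hL, hLi⟩, hLM⟩
  obtain ⟨M₀, hM₀⟩ := hbase
  choose! F hF using hstep
  let M : ℕ → Subgroup H := fun n => Nat.rec M₀ F n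
  have hMP : ∀ n, Φ (i₀ + n) ≤ M n ∧ (Φ (i₀ + n)).relIndex (M n) = p ^ κ (i₀ + n) := by
    intro n
    induction n with
    | zero => exact hM₀
    | succ n ih => exact (hF n (M n) ih).1
  have hKM := iInf_sup_eq_of_sup_eq (N := fun n => Φ (i₀ + n)) (M := M) (fun n => hopen _)
    (fun n => (hMP n).1) (fun a b hab => hanti (by omega)) (fun n => (hF n (M n) (hMP n)).2)
  refine ⟨⨅ n, M n, ?_, fun i hi => ?_⟩
  · rw [Subgroup.coe_iInf]
    exact isClosed_iInter fun n =>
      Subgroup.isClosed_of_isOpen _ (Subgroup.isOpen_mono (hMP n).1 (hopen _))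
  · obtain ⟨n, rfl⟩ := Nat.exists_eq_add_of_le hi
    rw [← (hMP n).2, ← hKM n, Subgroup.relIndex_sup_right]

/-- In a finitely generated pro-`p` group of positive rank gradient there are closed subgroups of
every density, with logarithmic orders within `1` of the ideal value. -/
theorem exists_isClosed_relIndex_frattiniSeries_near (hH : IsProP p H) (hfg : IsTopFG H)
    {ρ : ℝ} (hρ : 0 < ρ) {ℓ : ℕ → ℕ} (hℓ : ∀ i, (frattiniSeries p H i).index = p ^ ℓ i)
    (hgrowth : ∀ i, (ℓ i : ℝ) + 1 + ρ * (p : ℝ) ^ ℓ i ≤ ℓ (i + 1))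
    {α : ℝ} (hα : α ∈ Set.Icc (0 : ℝ) 1) :
    ∃ K : Subgroup H, IsClosed (K : Set H) ∧ ∀ᶠ i in Filter.atTop,
      ∃ k : ℕ, (frattiniSeries p H i).relIndex K = p ^ k ∧ |(k : ℝ) - α * ℓ i| ≤ 1 := by
  have := hH.compact
  have := hH.t2
  have hp : p.Prime := Fact.out
  -- The endpoints are realised by the trivial subgroup and the whole group. They are treated
  -- separately because the growth estimate below needs `0 < α < 1`.
  rcases hα.1.eq_or_lt with rfl | hα₀
  · exact ⟨⊥, isClosed_singleton, .of_forall fun i => ⟨0, by simp, by simp⟩⟩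
  rcases hα.2.eq_or_lt with rfl | hα₁
  · exact ⟨⊤, isClosed_univ, .of_forall fun i => ⟨ℓ i, by simp [hℓ], by simp⟩⟩
  obtain ⟨i₀, hi₀⟩ := Filter.eventually_atTop.1
    (eventually_floor_add_floor_mul_pow_le hα₀ hα₁ hρ hp.one_lt hgrowth)
  obtain ⟨K, hK, hKi⟩ := exists_isClosed_relIndex_frattiniSeries_eq hfg (i₀ := i₀)
    (κ := fun i => ⌊α * ℓ i⌋₊) hℓ
    (Nat.floor_le_of_le (mul_le_of_le_one_left (by positivity) hα₁.le)) hi₀ (fun i _ => by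
      have hle : (ℓ i : ℝ) ≤ ℓ (i + 1) := by
        have h1 : (0 : ℝ) ≤ ρ * (p : ℝ) ^ ℓ i := by positivity
        linarith [hgrowth i]
      have h1 := Nat.floor_le (show 0 ≤ α * (ℓ (i + 1) : ℝ) by positivity)
      have h2 := Nat.lt_floor_add_one (α * (ℓ i : ℝ))
      have h3 : α * ((ℓ (i + 1) : ℝ) - ℓ i) ≤ 1 * ((ℓ (i + 1) : ℝ) - ℓ i) :=
        mul_le_mul_of_nonneg_right hα₁.le (by linarith)
      have h4 : (⌊α * ℓ (i + 1)⌋₊ : ℝ) + ℓ i < ⌊α * ℓ i⌋₊ + ℓ (i + 1) + 1 := by linarith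
      exact Nat.lt_succ_iff.1 (by exact_mod_cast h4))
  refine ⟨K, hK, Filter.eventually_atTop.2 ⟨i₀, fun i hi => ⟨_, hKi i hi, ?_⟩⟩⟩
  have h1 := Nat.floor_le (show 0 ≤ α * (ℓ i : ℝ) by positivity)
  have h2 := Nat.lt_floor_add_one (α * (ℓ i : ℝ))
  rw [abs_le]
  constructor <;> linarith

end ProP

/-! ### The metric of a filtration series and its Hausdorff dimension -/

theorem seriesDist_nonneg {G : Type*} [Group G] (S : ℕ → Subgroup G) (x y : G) :
    0 ≤ seriesDist S x y := by
  refine Real.sInf_nonneg ?_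
  rintro _ ⟨i, -, rfl⟩
  positivity

theorem seriesDist_le {G : Type*} [Group G] {S : ℕ → Subgroup G} {x y : G} {i : ℕ}
    (h : x⁻¹ * y ∈ S i) : seriesDist S x y ≤ ((S i).index : ℝ)⁻¹ := by
  refine csInf_le ⟨0, ?_⟩ ⟨i, h, rfl⟩
  rintro _ ⟨i, -, rfl⟩
  positivity

theorem seriesDist_comm {G : Type*} [Group G] (S : ℕ → Subgroup G) (x y : G) :
    seriesDist S x y = seriesDist S y x := by
  unfold seriesDist
  congr 1
  ext d
  refine exists_congr fun i => and_congr_left fun _ => ?_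
  rw [← inv_mem_iff, mul_inv_rev, inv_inv]

/-- A filtration series of a topological group: a descending series of open subgroups, starting
with the whole group, with strictly increasing indices, that is a neighbourhood basis at `1`. -/
structure IsFiltrationSeries {G : Type*} [Group G] [TopologicalSpace G] (S : ℕ → Subgroup G) :
    Prop where
  antitone : Antitone S
  zero : S 0 = ⊤
  isOpen : ∀ i, IsOpen (S i : Set G)
  exists_subset : ∀ W ∈ nhds (1 : G), ∃ i, (S i : Set G) ⊆ W
  strictMono_index : StrictMono fun i => (S i).index

namespace IsFiltrationSeries

variable {G : Type*} [Group G] [TopologicalSpace G] {S : ℕ → Subgroup G}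

theorem index_pos (hS : IsFiltrationSeries S) (i : ℕ) : 0 < (S i).index := by
  have h1 : (S 0).index = 1 := by rw [hS.zero, Subgroup.index_top]
  have h2 := hS.strictMono_index.monotone (Nat.zero_le i)
  simp only [h1] at h2
  omega

theorem tendsto_index (hS : IsFiltrationSeries S) :
    Filter.Tendsto (fun i => (S i).index) Filter.atTop Filter.atTop :=
  hS.strictMono_index.tendsto_atTop

theorem inv_index_le (hS : IsFiltrationSeries S) {i j : ℕ} (hij : i ≤ j) :
    ((S j).index : ℝ)⁻¹ ≤ ((S i).index : ℝ)⁻¹ := by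
  have := hS.index_pos i
  exact inv_anti₀ (by positivity) (by exact_mod_cast hS.strictMono_index.monotone hij)

theorem inv_index_lt (hS : IsFiltrationSeries S) {i j : ℕ} (hij : i < j) :
    ((S j).index : ℝ)⁻¹ < ((S i).index : ℝ)⁻¹ := by
  have := hS.index_pos i
  exact inv_strictAnti₀ (by positivity) (by exact_mod_cast hS.strictMono_index hij)

theorem relIndex_pos (hS : IsFiltrationSeries S) (K : Subgroup G) (i : ℕ) :
    0 < (S i).relIndex K :=
  Nat.pos_of_ne_zero fun h => (hS.index_pos i).ne' (Subgroup.index_eq_zero_of_relIndex_eq_zero h)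

theorem relIndex_le_index (hS : IsFiltrationSeries S) (K : Subgroup G) (i : ℕ) :
    (S i).relIndex K ≤ (S i).index := by
  rw [← Subgroup.relIndex_top_right]
  refine Subgroup.relIndex_le_of_le_right le_top ?_
  rw [Subgroup.relIndex_top_right]
  exact (hS.index_pos i).ne'

theorem logb_div_logb_mem_Icc (hS : IsFiltrationSeries S) {p : ℕ} (hp : 1 < p)
    (K : Subgroup G) (i : ℕ) :
    Real.logb p ((S i).relIndex K : ℝ) / Real.logb p ((S i).index : ℝ) ∈ Set.Icc (0 : ℝ) 1 := by
  have hp1 : (1 : ℝ) < p := by exact_mod_cast hp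
  have h1 : (1 : ℝ) ≤ (S i).relIndex K := by exact_mod_cast hS.relIndex_pos K i
  have h2 : ((S i).relIndex K : ℝ) ≤ (S i).index := by exact_mod_cast hS.relIndex_le_index K i
  have h3 := Real.logb_nonneg hp1 h1
  have h4 := Real.logb_le_logb_of_le hp1 (by linarith) h2
  exact ⟨div_nonneg h3 (h3.trans h4), div_le_one_of_le₀ h4 (h3.trans h4)⟩

/-- The term `i = 0` is excluded because there the quotient is the junk value `0 / 0 = 0`. -/
theorem logb_div_logb_lt_iff (hS : IsFiltrationSeries S) {p : ℕ} (hp : 1 < p)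
    (K : Subgroup G) {i : ℕ} (hi : 0 < i) (d : ℝ) :
    Real.logb p ((S i).relIndex K : ℝ) / Real.logb p ((S i).index : ℝ) < d ↔
      ((S i).relIndex K : ℝ) < ((S i).index : ℝ) ^ d := by
  have hp1 : (1 : ℝ) < p := by exact_mod_cast hp
  have h1 : (0 : ℝ) < (S i).relIndex K := by exact_mod_cast hS.relIndex_pos K i
  have h2 : (1 : ℝ) < (S i).index := by
    have h := hS.strictMono_index hi
    have h0 := hS.index_pos 0
    simp only at h
    exact_mod_cast (by omega : 1 < (S i).index)
  rw [div_lt_iff₀ (Real.logb_pos hp1 h2), ← Real.logb_rpow_eq_mul_logb_of_pos (by linarith),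
    Real.logb_lt_logb_iff hp1 h1 (Real.rpow_pos_of_pos (by linarith) d)]

theorem tendsto_inv_index (hS : IsFiltrationSeries S) :
    Filter.Tendsto (fun i => ((S i).index : ENNReal)⁻¹) Filter.atTop (nhds 0) :=
  ENNReal.tendsto_inv_nat_nhds_zero.comp hS.tendsto_index

theorem exists_inv_index_lt (hS : IsFiltrationSeries S) {ε : ℝ} (hε : 0 < ε) :
    ∃ i, ((S i).index : ℝ)⁻¹ < ε := by
  have h := tendsto_inv_atTop_zero.comp
    ((tendsto_natCast_atTop_atTop (R := ℝ)).comp hS.tendsto_index)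
  exact (h.eventually (gt_mem_nhds hε)).exists

theorem inv_index_le_seriesDist (hS : IsFiltrationSeries S) {x y : G} {i : ℕ}
    (h : x⁻¹ * y ∉ S (i + 1)) : ((S i).index : ℝ)⁻¹ ≤ seriesDist S x y := by
  refine le_csInf ⟨_, 0, by rw [hS.zero]; trivial, rfl⟩ ?_
  rintro _ ⟨j, hj, rfl⟩
  refine hS.inv_index_le ?_
  by_contra! hij
  exact h (hS.antitone hij hj)

theorem seriesDist_le_inv_index_iff (hS : IsFiltrationSeries S) {x y : G} {i : ℕ} :
    seriesDist S x y ≤ ((S i).index : ℝ)⁻¹ ↔ x⁻¹ * y ∈ S i := by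
  refine ⟨fun h => ?_, seriesDist_le⟩
  cases i with
  | zero => rw [hS.zero]; trivial
  | succ i =>
    by_contra hc
    exact (hS.inv_index_lt (Nat.lt_succ_self i)).not_ge ((hS.inv_index_le_seriesDist hc).trans h)

theorem seriesDist_self (hS : IsFiltrationSeries S) (x : G) : seriesDist S x x = 0 := by
  refine le_antisymm (le_of_forall_pos_lt_add fun ε hε => ?_) (seriesDist_nonneg S x x)
  obtain ⟨i, hi⟩ := hS.exists_inv_index_lt hε
  rw [zero_add]
  exact (seriesDist_le (by simp)).trans_lt hi

theorem exists_mem_notMem [T1Space G] (hS : IsFiltrationSeries S) {x y : G} (hxy : x ≠ y) :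
    ∃ i, x⁻¹ * y ∈ S i ∧ x⁻¹ * y ∉ S (i + 1) := by
  have h1 : x⁻¹ * y ≠ 1 := fun h => hxy (inv_mul_eq_one.1 h)
  obtain ⟨n, hn⟩ := hS.exists_subset {x⁻¹ * y}ᶜ (isOpen_compl_singleton.mem_nhds h1.symm)
  by_contra! hc
  have : ∀ i, x⁻¹ * y ∈ S i := fun i => by
    induction i with
    | zero => rw [hS.zero]; trivial
    | succ i ih => exact hc i ih
  exact hn (this n) rfl

theorem eq_of_seriesDist_eq_zero [T1Space G] (hS : IsFiltrationSeries S) {x y : G}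
    (h : seriesDist S x y = 0) : x = y := by
  by_contra hxy
  obtain ⟨i, -, hi⟩ := hS.exists_mem_notMem hxy
  have h1 := hS.inv_index_le_seriesDist hi
  have h2 := hS.index_pos i
  rw [h] at h1
  exact h1.not_gt (by positivity)

/-- The ultrametric inequality holds as well, but only this consequence is needed. -/
theorem seriesDist_triangle [T1Space G] (hS : IsFiltrationSeries S) (x y z : G) :
    seriesDist S x z ≤ seriesDist S x y + seriesDist S y z := by
  rcases eq_or_ne x y with rfl | hxy
  · rw [hS.seriesDist_self, zero_add]
  rcases eq_or_ne y z with rfl | hyz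
  · rw [hS.seriesDist_self, add_zero]
  obtain ⟨i, hi, hi'⟩ := hS.exists_mem_notMem hxy
  obtain ⟨j, hj, hj'⟩ := hS.exists_mem_notMem hyz
  have h1 := hS.inv_index_le_seriesDist hi'
  have h2 := hS.inv_index_le_seriesDist hj'
  have h3 := seriesDist_nonneg S x y
  have h4 := seriesDist_nonneg S y z
  have hprod : x⁻¹ * z = (x⁻¹ * y) * (y⁻¹ * z) := by group
  rcases le_total i j with hij | hij
  · have := seriesDist_le (S := S) (x := x) (y := z) (i := i)
      (hprod ▸ mul_mem hi (hS.antitone hij hj))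
    linarith
  · have := seriesDist_le (S := S) (x := x) (y := z) (i := j)
      (hprod ▸ mul_mem (hS.antitone hij hi) hj)
    linarith

/-- The distance of a filtration series is compatible with the topology of the group. -/
theorem isOpen_iff [IsTopologicalGroup G] (hS : IsFiltrationSeries S) (s : Set G) :
    IsOpen s ↔ ∀ x ∈ s, ∃ ε > 0, ∀ y, seriesDist S x y < ε → y ∈ s := by
  refine ⟨fun hs x hx => ?_, fun h => isOpen_iff_forall_mem_open.2 fun x hx => ?_⟩
  · obtain ⟨i, hi⟩ := hS.exists_subset ((fun y => x * y) ⁻¹' s)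
      ((hs.preimage (continuous_const_mul x)).mem_nhds (by simpa using hx))
    have := hS.index_pos i
    refine ⟨((S i).index : ℝ)⁻¹, by positivity, fun y hy => ?_⟩
    simpa using hi (hS.seriesDist_le_inv_index_iff.1 hy.le)
  · obtain ⟨ε, hε, hs⟩ := h x hx
    obtain ⟨i, hi⟩ := hS.exists_inv_index_lt hε
    exact ⟨(fun y => x⁻¹ * y) ⁻¹' S i, fun y hy => hs y ((seriesDist_le hy).trans_lt hi),
      (hS.isOpen i).preimage (continuous_const_mul _), by simp⟩

/-- The metric of a filtration series; it induces the given topology, definitionally. -/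
noncomputable abbrev metricSpace [IsTopologicalGroup G] [T1Space G]
    (hS : IsFiltrationSeries S) : MetricSpace G :=
  .ofDistTopology (seriesDist S) hS.seriesDist_self (seriesDist_comm S) hS.seriesDist_triangle
    hS.isOpen_iff fun _ _ => hS.eq_of_seriesDist_eq_zero

end IsFiltrationSeries

section Dimension

open MeasureTheory Filter Topology
open scoped ENNReal NNReal

/-- On a closed subgroup `K` of a compact group there is a probability measure for which left
cosets of an open subgroup `L` have mass at most `|K : K ∩ L|⁻¹`: the Haar measure of `K`. -/
theorem exists_measure_coset_le {X : Type*} [TopologicalSpace X] [T2Space X] [Group X]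
    [IsTopologicalGroup X] [CompactSpace X] [MeasurableSpace X] [BorelSpace X] {K : Subgroup X}
    (hK : IsClosed (K : Set X)) :
    ∃ ν : Measure X, ν K = 1 ∧ ∀ L : Subgroup X, IsOpen (L : Set X) → ∀ x : X,
      ν {y | x⁻¹ * y ∈ L} ≤ (L.relIndex K : ℝ≥0∞)⁻¹ := by
  have : CompactSpace K := isCompact_iff_compactSpace.1 hK.isCompact
  set μ : Measure K := Measure.haarMeasure ⊤ with hμ
  have hμ1 : μ Set.univ = 1 :=
    Measure.haarMeasure_self (K₀ := (⊤ : TopologicalSpace.PositiveCompacts K))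
  have hval : Measurable (Subtype.val : K → X) := measurable_subtype_coe
  refine ⟨μ.map Subtype.val, ?_, fun L hL x => ?_⟩
  · rw [Measure.map_apply hval hK.measurableSet, ← hμ1]
    congr 1
    ext k
    simp
  · have hopen : IsOpen {y | x⁻¹ * y ∈ L} := hL.preimage (continuous_const_mul x⁻¹)
    rw [Measure.map_apply hval hopen.measurableSet]
    rcases (Subtype.val ⁻¹' {y | x⁻¹ * y ∈ L} : Set K).eq_empty_or_nonempty with he | ⟨k, hk⟩
    · rw [he, measure_empty]
      exact zero_le
    have hLK : IsOpen (L.subgroupOf K : Set K) := hL.preimage continuous_subtype_val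
    have : Finite (K ⧸ L.subgroupOf K) := (L.subgroupOf K).quotient_finite_of_isOpen hLK
    have : (L.subgroupOf K).FiniteIndex := Subgroup.finiteIndex_of_finite_quotient
    have h1 := Subgroup.index_mul_measure (L.subgroupOf K) hLK.measurableSet μ
    have hset : (Subtype.val ⁻¹' {y | x⁻¹ * y ∈ L} : Set K) =
        (fun z => k⁻¹ * z) ⁻¹' (L.subgroupOf K : Set K) := by
      ext z
      have hk' : x⁻¹ * (k : X) ∈ L := hk
      have hz : x⁻¹ * (z : X) = (x⁻¹ * k) * (((k⁻¹ * z : K)) : X) := by push_cast; group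
      change x⁻¹ * (z : X) ∈ L ↔ ((k⁻¹ * z : K) : X) ∈ L
      rw [hz, Subgroup.mul_mem_cancel_left _ hk']
    rw [hset, measure_preimage_mul, ENNReal.le_inv_iff_mul_le, mul_comm]
    exact (h1.trans hμ1).le

variable {X : Type*} [MetricSpace X] [Group X]
  {S : ℕ → Subgroup X}

theorem IsFiltrationSeries.edist_le_iff (hS : IsFiltrationSeries S)
    (hdist : ∀ x y, dist x y = seriesDist S x y) {x y : X} {i : ℕ} :
    edist x y ≤ ((S i).index : ℝ≥0∞)⁻¹ ↔ x⁻¹ * y ∈ S i := by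
  have hpos := hS.index_pos i
  have h1 : ((S i).index : ℝ≥0∞)⁻¹ = ENNReal.ofReal ((S i).index : ℝ)⁻¹ := by
    rw [ENNReal.ofReal_inv_of_pos (by positivity), ENNReal.ofReal_natCast]
  rw [h1, edist_dist, ENNReal.ofReal_le_ofReal_iff (by positivity), hdist,
    hS.seriesDist_le_inv_index_iff]

theorem IsFiltrationSeries.inv_index_le_edist (hS : IsFiltrationSeries S)
    (hdist : ∀ x y, dist x y = seriesDist S x y) {x y : X} {i : ℕ} (h : x⁻¹ * y ∉ S (i + 1)) :
    ((S i).index : ℝ≥0∞)⁻¹ ≤ edist x y := by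
  have hpos := hS.index_pos i
  have h1 : ((S i).index : ℝ≥0∞)⁻¹ = ENNReal.ofReal ((S i).index : ℝ)⁻¹ := by
    rw [ENNReal.ofReal_inv_of_pos (by positivity), ENNReal.ofReal_natCast]
  rw [h1, edist_dist, hdist]
  exact ENNReal.ofReal_le_ofReal (hS.inv_index_le_seriesDist h)

/-- The upper bound: `K` is covered by `|K : K ∩ S i|` cosets of diameter at most
`|G : S i|⁻¹`. -/
theorem IsFiltrationSeries.dimH_le [IsTopologicalGroup X] [CompactSpace X]
    (hS : IsFiltrationSeries S)
    (hdist : ∀ x y, dist x y = seriesDist S x y) (K : Subgroup X) (d : ℝ≥0)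
    (hd : ∃ᶠ i in atTop, ((S i).relIndex K : ℝ) ≤ ((S i).index : ℝ) ^ (d : ℝ)) :
    dimH (K : Set X) ≤ d := by
  classical
  borelize X
  have hfin : ∀ i, Finite (K ⧸ (S i).subgroupOf K) := fun i =>
    Nat.finite_of_card_ne_zero (hS.relIndex_pos K i).ne'
  have hfint : ∀ i, Fintype (K ⧸ (S i).subgroupOf K) := fun i => Fintype.ofFinite _
  let t : ∀ i, (K ⧸ (S i).subgroupOf K) → Set X := fun i q => {y | ((q.out : K) : X)⁻¹ * y ∈ S i}
  have hdiam : ∀ i q, Metric.ediam (t i q) ≤ ((S i).index : ℝ≥0∞)⁻¹ := fun i q => by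
    refine Metric.ediam_le fun x hx y hy => (hS.edist_le_iff hdist).2 ?_
    have hxy : x⁻¹ * y = (((q.out : K) : X)⁻¹ * x)⁻¹ * (((q.out : K) : X)⁻¹ * y) := by group
    rw [hxy]
    exact mul_mem (inv_mem hx) hy
  have hcover : ∀ i, (K : Set X) ⊆ ⋃ q, t i q := fun i x hx => by
    refine Set.mem_iUnion.2 ⟨((⟨x, hx⟩ : K) : K ⧸ (S i).subgroupOf K), ?_⟩
    have h1 : (((⟨x, hx⟩ : K) : K ⧸ (S i).subgroupOf K).out : K ⧸ (S i).subgroupOf K) =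
        ((⟨x, hx⟩ : K) : K ⧸ (S i).subgroupOf K) := Quotient.out_eq' _
    exact Subgroup.mem_subgroupOf.1 (QuotientGroup.eq.1 h1)
  have hle := Measure.hausdorffMeasure_le_liminf_sum (d : ℝ) (K : Set X) (l := atTop) _
    hS.tendsto_inv_index t (.of_forall hdiam) (.of_forall hcover)
  refine dimH_le_of_hausdorffMeasure_ne_top (ne_top_of_le_ne_top ENNReal.one_ne_top
    (hle.trans (liminf_le_of_frequently_le' (hd.mono fun i hi => ?_))))
  have hpos := hS.index_pos i
  calc ∑ q, Metric.ediam (t i q) ^ (d : ℝ)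
      ≤ ∑ _q : K ⧸ (S i).subgroupOf K, (((S i).index : ℝ≥0∞)⁻¹) ^ (d : ℝ) :=
        Finset.sum_le_sum fun q _ => ENNReal.rpow_le_rpow (hdiam i q) d.2
    _ = ((S i).relIndex K : ℝ≥0∞) * (((S i).index : ℝ≥0∞) ^ (d : ℝ))⁻¹ := by
        rw [Finset.sum_const, nsmul_eq_mul, ENNReal.inv_rpow, Finset.card_univ,
          ← Nat.card_eq_fintype_card]
        rfl
    _ ≤ 1 := by
        rw [← div_eq_mul_inv]
        refine ENNReal.div_le_of_le_mul ?_
        rw [one_mul]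
        have h := ENNReal.ofReal_le_ofReal hi
        rwa [ENNReal.ofReal_natCast, ← ENNReal.ofReal_rpow_of_pos (by positivity),
          ENNReal.ofReal_natCast] at h

/-- The lower bound: the Haar measure of `K` satisfies the mass distribution principle in
dimension `d`. -/
theorem IsFiltrationSeries.le_dimH [IsTopologicalGroup X] [CompactSpace X]
    (hS : IsFiltrationSeries S)
    (hdist : ∀ x y, dist x y = seriesDist S x y) {K : Subgroup X} (hK : IsClosed (K : Set X))
    (d : ℝ≥0) (hd : ∀ᶠ i in atTop, ((S i).index : ℝ) ^ (d : ℝ) ≤ ((S i).relIndex K : ℝ)) :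
    d ≤ dimH (K : Set X) := by
  borelize X
  rcases eq_or_ne d 0 with rfl | hd0
  · exact zero_le
  have hdpos : (0 : ℝ) < d := by exact_mod_cast pos_iff_ne_zero.2 hd0
  obtain ⟨ν, hν, hνS⟩ := exists_measure_coset_le hK
  obtain ⟨i₀, hi₀⟩ := eventually_atTop.1 hd
  have hsmall : ∀ s : Set X, ∀ n, i₀ ≤ n → Metric.ediam s ≤ ((S n).index : ℝ≥0∞)⁻¹ →
      ν s ≤ (((S n).index : ℝ≥0∞)⁻¹) ^ (d : ℝ) := by
    intro s n hn hs
    rcases s.eq_empty_or_nonempty with rfl | ⟨x, hx⟩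
    · simp
    have hsub : s ⊆ {y | x⁻¹ * y ∈ S n} := fun y hy =>
      (hS.edist_le_iff hdist).1 ((Metric.edist_le_ediam_of_mem hx hy).trans hs)
    refine (measure_mono hsub).trans ((hνS _ (hS.isOpen n) x).trans ?_)
    rw [ENNReal.inv_rpow, ENNReal.inv_le_inv]
    have hpos := hS.index_pos n
    have h := ENNReal.ofReal_le_ofReal (hi₀ n hn)
    rwa [ENNReal.ofReal_natCast, ← ENNReal.ofReal_rpow_of_pos (by positivity),
      ENNReal.ofReal_natCast] at h
  have hle : ν ≤ Measure.hausdorffMeasure (d : ℝ) := by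
    refine Measure.le_hausdorffMeasure _ _ ((S i₀).index : ℝ≥0∞)⁻¹ (by simp) fun s hs => ?_
    -- Either `s` has diameter `0`, or its diameter is exactly the inverse index of the last term
    -- of the series one of whose cosets contains `s`.
    by_cases hall : ∀ n, i₀ ≤ n → Metric.ediam s ≤ ((S n).index : ℝ≥0∞)⁻¹
    · have h0 : Tendsto (fun n => (((S n).index : ℝ≥0∞)⁻¹) ^ (d : ℝ)) atTop (𝓝 0) := by
        have := (ENNReal.continuous_rpow_const (y := (d : ℝ))).tendsto 0 |>.comp
          hS.tendsto_inv_index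
        rwa [ENNReal.zero_rpow_of_pos hdpos] at this
      exact (ge_of_tendsto h0 (eventually_atTop.2
        ⟨i₀, fun n hn => hsmall s n hn (hall n hn)⟩)).trans zero_le
    · push Not at hall
      classical
      obtain ⟨hn, hns⟩ := Nat.find_spec hall
      set n := Nat.find hall with hndef
      have hn0 : i₀ < n := lt_of_le_of_ne hn fun h => hns.not_ge (h ▸ hs)
      obtain ⟨m, hm⟩ : ∃ m, n = m + 1 := ⟨n - 1, by omega⟩
      have hms : Metric.ediam s ≤ ((S m).index : ℝ≥0∞)⁻¹ := by
        by_contra! hc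
        exact Nat.find_min hall (m := m) (by omega) ⟨by omega, hc⟩
      refine (hsmall s m (by omega) hms).trans (ENNReal.rpow_le_rpow ?_ d.2)
      by_contra! hc
      refine hns.not_ge (Metric.ediam_le fun x hx y hy => (hS.edist_le_iff hdist).2 ?_)
      by_contra hxy
      rw [hm] at hxy
      exact ((hS.inv_index_le_edist hdist hxy).trans
        (Metric.edist_le_ediam_of_mem hx hy)).not_gt hc
  refine le_dimH_of_hausdorffMeasure_ne_zero fun h0 => ?_
  have := hle (K : Set X)
  rw [hν, h0] at this
  exact one_ne_zero (le_zero_iff.1 this)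

/-- The Hausdorff dimension of a closed subgroup, with respect to the metric of a filtration
series, is its lower logarithmic density. -/
theorem IsFiltrationSeries.dimH_eq [IsTopologicalGroup X] [CompactSpace X]
    (hS : IsFiltrationSeries S)
    (hdist : ∀ x y, dist x y = seriesDist S x y) {p : ℕ} (hp : 1 < p) {K : Subgroup X}
    (hK : IsClosed (K : Set X)) :
    dimH (K : Set X) = ENNReal.ofReal (subgroupHDim p S K) := by
  have hmem := hS.logb_div_logb_mem_Icc hp K
  have hbdd : IsBoundedUnder (· ≥ ·) atTop fun i : ℕ =>
      Real.logb p ((S i).relIndex K : ℝ) / Real.logb p ((S i).index : ℝ) :=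
    isBoundedUnder_of ⟨0, fun i => (hmem i).1⟩
  have hcobdd : IsCoboundedUnder (· ≥ ·) atTop fun i : ℕ =>
      Real.logb p ((S i).relIndex K : ℝ) / Real.logb p ((S i).index : ℝ) :=
    (isBoundedUnder_of ⟨1, fun i => (hmem i).2⟩ :
      IsBoundedUnder (· ≤ ·) atTop _).isCoboundedUnder_ge
  refine le_antisymm (le_of_forall_gt_imp_ge_of_dense fun a ha => ?_)
    (ENNReal.le_of_forall_nnreal_lt fun d hd => ?_)
  · induction a with
    | top => exact le_top
    | coe d =>
      have hlt : subgroupHDim p S K < d := by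
        rw [← ENNReal.ofReal_coe_nnreal] at ha
        exact (ENNReal.ofReal_lt_ofReal_iff'.1 ha).1
      refine hS.dimH_le hdist K d ?_
      refine ((frequently_lt_of_liminf_lt hcobdd hlt).and_eventually
        (eventually_gt_atTop 0)).mono ?_
      rintro i ⟨hi, hi0⟩
      exact ((hS.logb_div_logb_lt_iff hp K hi0 d).1 hi).le
  · have hlt : (d : ℝ) < subgroupHDim p S K := by
      rw [← ENNReal.ofReal_coe_nnreal] at hd
      exact (ENNReal.ofReal_lt_ofReal_iff'.1 hd).1
    refine hS.le_dimH hdist hK d ?_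
    filter_upwards [eventually_lt_of_lt_liminf hlt hbdd, eventually_gt_atTop 0] with i hi hi0
    by_contra! hc
    exact hi.not_gt ((hS.logb_div_logb_lt_iff hp K hi0 d).2 hc)

end Dimension

/-! ### Products of pro-`p` groups of positive rank gradient -/

theorem relIndex_pi_univ {ι : Type*} [Fintype ι] {H : ι → Type*} [∀ j, Group (H j)]
    (A K : ∀ j, Subgroup (H j)) [∀ j, (A j).Normal] :
    (Subgroup.pi Set.univ A).relIndex (Subgroup.pi Set.univ K) = ∏ j, (A j).relIndex (K j) := by
  let f : (∀ j, H j) →* ∀ j, H j ⧸ A j :=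
    MonoidHom.pi fun j => (QuotientGroup.mk' (A j)).comp (Pi.evalMonoidHom H j)
  have hker : f.ker = Subgroup.pi Set.univ A := by
    ext x
    simp only [MonoidHom.mem_ker, Subgroup.mem_pi, Set.mem_univ, true_imp_iff]
    rw [funext_iff]
    exact forall_congr' fun j => QuotientGroup.eq_one_iff (x j)
  have hmap : (Subgroup.pi Set.univ K).map f =
      Subgroup.pi Set.univ fun j => (K j).map (QuotientGroup.mk' (A j)) := by
    ext y
    simp only [Subgroup.mem_map, Subgroup.mem_pi, Set.mem_univ, true_imp_iff]
    constructor
    · rintro ⟨x, hx, rfl⟩ j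
      exact ⟨x j, hx j, rfl⟩
    · intro h
      choose x hx hxy using h
      exact ⟨x, hx, funext hxy⟩
  have hcard : ∀ L : ∀ j, Subgroup (H j ⧸ A j),
      Nat.card (Subgroup.pi Set.univ L) = ∏ j, Nat.card (L j) := fun L => by
    rw [← Nat.card_pi]
    exact Nat.card_congr (Equiv.Set.univPi fun j => (L j : Set (H j ⧸ A j)))
  rw [← hker, Subgroup.relIndex_ker, hmap, hcard]
  refine Finset.prod_congr rfl fun j _ => ?_
  rw [← Subgroup.relIndex_ker, QuotientGroup.ker_mk']

theorem index_pi_univ {ι : Type*} [Fintype ι] {H : ι → Type*} [∀ j, Group (H j)]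
    (A : ∀ j, Subgroup (H j)) [∀ j, (A j).Normal] :
    (Subgroup.pi Set.univ A).index = ∏ j, (A j).index := by
  have h := relIndex_pi_univ A fun _ => ⊤
  rw [Subgroup.pi_top] at h
  simpa only [Subgroup.relIndex_top_right] using h

section Product

open Filter Topology

variable {p : ℕ} {ι : Type*} [Fintype ι] {H : ι → Type*} [∀ j, Group (H j)]
  [∀ j, TopologicalSpace (H j)] [∀ j, IsTopologicalGroup (H j)] {ℓ : ι → ℕ → ℕ}

theorem index_frattiniSeries_pi (hℓ : ∀ j i, (frattiniSeries p (H j) i).index = p ^ ℓ j i)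
    (i : ℕ) : (frattiniSeries p (∀ j, H j) i).index = p ^ ∑ j, ℓ j i := by
  rw [frattiniSeries_pi, index_pi_univ]
  simp only [hℓ, Finset.prod_pow_eq_pow_sum]

theorem isFiltrationSeries_frattiniSeries_pi [Fact p.Prime] [Nonempty ι]
    (hproP : ∀ j, IsProP p (H j)) (hfg : ∀ j, IsTopFG (H j))
    (hℓ : ∀ j i, (frattiniSeries p (H j) i).index = p ^ ℓ j i)
    (hmono : ∀ j, StrictMono (ℓ j)) : IsFiltrationSeries (frattiniSeries p (∀ j, H j)) where
  antitone := antitone_frattiniSeries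
  zero := rfl
  isOpen i := by
    rw [frattiniSeries_pi]
    refine isOpen_set_pi Set.finite_univ fun j _ => ?_
    have := (hproP j).compact
    exact isOpen_frattiniSeries (hfg j) i
  exists_subset W hW := by
    rw [nhds_pi, Filter.mem_pi] at hW
    obtain ⟨I, -, t, ht, htW⟩ := hW
    choose n hn using fun j => exists_frattiniSeries_subset (hproP j) (ht j)
    refine ⟨Finset.univ.sup n, fun x hx => htW fun j _ => hn j ?_⟩
    rw [frattiniSeries_pi] at hx
    exact antitone_frattiniSeries (Finset.le_sup (Finset.mem_univ j)) (hx j trivial)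
  strictMono_index := by
    have hp : p.Prime := Fact.out
    intro a b hab
    simp only [index_frattiniSeries_pi hℓ]
    exact Nat.pow_lt_pow_right hp.one_lt
      (Finset.sum_lt_sum_of_nonempty Finset.univ_nonempty fun j _ => hmono j hab)

/-- A product of subgroups whose logarithmic orders are within `1` of density `α` in every factor
has Hausdorff dimension `α`, since the logarithmic indices add up and tend to infinity. -/
theorem subgroupHDim_pi_eq [Fact p.Prime] [Nonempty ι]
    (hℓ : ∀ j i, (frattiniSeries p (H j) i).index = p ^ ℓ j i)
    (hmono : ∀ j, StrictMono (ℓ j)) {α : ℝ} {K : ∀ j, Subgroup (H j)}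
    (hK : ∀ j, ∀ᶠ i in atTop, ∃ k : ℕ, (frattiniSeries p (H j) i).relIndex (K j) = p ^ k ∧
      |(k : ℝ) - α * ℓ j i| ≤ 1) :
    subgroupHDim p (frattiniSeries p (∀ j, H j)) (Subgroup.pi Set.univ K) = α := by
  have hp : p.Prime := Fact.out
  have hp1 : (1 : ℝ) < p := by exact_mod_cast hp.one_lt
  have hlog : ∀ n : ℕ, Real.logb p (((p ^ n : ℕ) : ℝ)) = n := fun n => by
    push_cast
    rw [← Real.rpow_natCast, Real.logb_rpow (by linarith) hp1.ne']
  have hL : StrictMono fun i => ∑ j, ℓ j i := fun a b hab =>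
    Finset.sum_lt_sum_of_nonempty Finset.univ_nonempty fun j _ => hmono j hab
  have hLt : Tendsto (fun i => ((∑ j, ℓ j i : ℕ) : ℝ)) atTop atTop :=
    tendsto_natCast_atTop_atTop.comp hL.tendsto_atTop
  have hzero : Tendsto (fun i => (Fintype.card ι : ℝ) / ((∑ j, ℓ j i : ℕ) : ℝ)) atTop (𝓝 0) :=
    tendsto_const_nhds.div_atTop hLt
  refine Tendsto.liminf_eq ((tendsto_iff_dist_tendsto_zero).2 ?_)
  refine squeeze_zero' (.of_forall fun _ => dist_nonneg) ?_ hzero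
  filter_upwards [eventually_all.2 hK, hLt.eventually_gt_atTop 0] with i hi hpos
  choose k hk hkα using hi
  rw [index_frattiniSeries_pi hℓ, frattiniSeries_pi, relIndex_pi_univ, Finset.prod_congr rfl
    fun j _ => hk j, Finset.prod_pow_eq_pow_sum, hlog, hlog, Real.dist_eq,
    div_sub' hpos.ne', abs_div, abs_of_pos hpos]
  refine div_le_div_of_nonneg_right ?_ hpos.le
  push_cast
  rw [mul_comm, Finset.mul_sum, ← Finset.sum_sub_distrib]
  calc |∑ j, ((k j : ℝ) - α * ℓ j i)| ≤ ∑ j, |(k j : ℝ) - α * ℓ j i| :=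
        Finset.abs_sum_le_sum_abs _ _
    _ ≤ ∑ _j : ι, (1 : ℝ) := Finset.sum_le_sum fun j _ => hkα j
    _ = Fintype.card ι := by simp

end Product

theorem IsFiltrationSeries.subgroupHDim_mem_Icc {G : Type*} [Group G] [TopologicalSpace G]
    {S : ℕ → Subgroup G} (hS : IsFiltrationSeries S) {p : ℕ} (hp : 1 < p) (K : Subgroup G) :
    subgroupHDim p S K ∈ Set.Icc (0 : ℝ) 1 := by
  have hmem := hS.logb_div_logb_mem_Icc hp K
  have hbdd := Filter.isBoundedUnder_of (f := Filter.atTop) (r := (· ≥ ·))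
    ⟨(0 : ℝ), fun i => (hmem i).1⟩
  have hcobdd := (Filter.isBoundedUnder_of (f := Filter.atTop) (r := (· ≤ ·))
    ⟨(1 : ℝ), fun i => (hmem i).2⟩).isCoboundedUnder_ge
  exact ⟨Filter.le_liminf_of_le hcobdd (.of_forall fun i => (hmem i).1),
    Filter.liminf_le_of_le hbdd fun b hb => by
      obtain ⟨i, hi⟩ := hb.exists
      exact hi.trans (hmem i).2⟩

theorem theorem1p2 (p : ℕ) [Fact p.Prime] {r : ℕ} (hr : 0 < r) (H : Fin r → Type*)
    [∀ j, Group (H j)] [∀ j, TopologicalSpace (H j)] [∀ j, IsTopologicalGroup (H j)]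
    (hproP : ∀ j, IsProP p (H j)) (hfg : ∀ j, IsTopFG (H j))
    (hRG : ∀ j, 0 < rankGradient (H j)) :
    (∃ m : MetricSpace (∀ j, H j),
        (∀ x y, m.dist x y = seriesDist (frattiniSeries p (∀ j, H j)) x y) ∧
        ∀ K : Subgroup (∀ j, H j), IsClosed (K : Set (∀ j, H j)) →
          metricHDim m (K : Set (∀ j, H j)) =
            ENNReal.ofReal (subgroupHDim p (frattiniSeries p (∀ j, H j)) K)) ∧
      hausdorffSpectrum p (frattiniSeries p (∀ j, H j)) = Set.Icc (0 : ℝ) 1 := by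
  have hp : p.Prime := Fact.out
  have : Nonempty (Fin r) := ⟨⟨0, hr⟩⟩
  have : ∀ j, CompactSpace (H j) := fun j => (hproP j).compact
  have : ∀ j, T2Space (H j) := fun j => (hproP j).t2
  choose ρ ℓ hρ hℓ hgrowth using fun j =>
    exists_index_frattiniSeries_eq_pow (hproP j) (hfg j) (hRG j)
  have hmono : ∀ j, StrictMono (ℓ j) := fun j => strictMono_nat_of_lt_succ fun i => by
    have h1 : 0 < ρ j * (p : ℝ) ^ ℓ j i :=
      mul_pos (hρ j) (pow_pos (by exact_mod_cast hp.pos) _)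
    have h2 := hgrowth j i
    exact_mod_cast (by linarith : (ℓ j i : ℝ) < ℓ j (i + 1))
  have hS : IsFiltrationSeries (frattiniSeries p (∀ j, H j)) :=
    isFiltrationSeries_frattiniSeries_pi hproP hfg hℓ hmono
  refine ⟨⟨hS.metricSpace, fun _ _ => rfl, fun K hK => ?_⟩, Set.Subset.antisymm ?_ fun α hα => ?_⟩
  · exact @IsFiltrationSeries.dimH_eq (∀ j, H j) hS.metricSpace _ _ _ _ hS (fun _ _ => rfl) p
      hp.one_lt K hK
  · rintro _ ⟨K, -, rfl⟩
    exact hS.subgroupHDim_mem_Icc hp.one_lt K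
  · choose K hK hKi using fun j => exists_isClosed_relIndex_frattiniSeries_near (hproP j) (hfg j)
      (hρ j) (hℓ j) (hgrowth j) hα
    exact ⟨Subgroup.pi Set.univ K, isClosed_set_pi fun j _ => hK j,
      subgroupHDim_pi_eq hℓ hmono hKi⟩
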